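/- **Optimality of zero-padding delivery for the random placement.** A server holds $N$ files $W_1,\dots,W_N$ of $F$ independent uniform bits each; there are $K\le N$ users, and real numbers $0\le M_1\le\dots\le M_K\le N$. *Random placement.* Independently for all $k$ and $n$, user $k$ stores the bits of $W_n$ at a uniformly random set of $\lfloor M_kF/N\rfloor$ positions. The resulting placement $C$ is known to the server and to all users. *Delivery schemes.* For every $F$, every placement $C$ and all requests $d=(d_1,\dots,d_K)\in\{1,\dots,N\}^K$, a delivery scheme $S$ specifies a number $\ell_S(F,C,d)$, an encoder that maps $(W_1,\dots,W_N)$ to a broadcast signal of $\ell_S(F,C,d)$ bits, and for every user $k$ a decoder that computes an estimate of $W_{d_k}$ from the signal and from the bits stored by user $k$. The maps are otherwise arbitrary. The scheme is *reliable under $d$* if for every user the error probability (over the random placement and the files) tends to $0$ as $F\to\infty$, and *reliable* if this holds for all $d$. Its load is $\ell_S(F,C,d)/F$, and its worst-case load is $R_S=\max_{d}\ \limsup_{F\to\infty}\mathbb E_C\left[\ell_S(F,C,d)\right]/F$. *Zero-padding scheme $\mathfrak F_o$.* For $T\subseteq\{1,\dots,K\}$ let $W_{n,T}$ consist of the bits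 of $W_n$ that are stored by exactly the users in $T$, and let $V_{k,T}=W_{d_k,T}$. For every non-empty set $U$ of users the server sends $X_U=\bigoplus_{k\in U}V_{k,U\setminus\{k\}}$, each segment being padded by zeros to the length $\max_{k\in U}|V_{k,U\setminus\{k\}}|$. *Theorem.* 1. With $\mathfrak F_o$ every user recovers its file without error, for all $F$, placements, requests and files. 2. $\mathfrak F_o$ is optimal for this placement: $R_{\mathfrak F_o}=\min\{R_S : S \text{ a reliable delivery scheme}\}$. 3. Moreover, for all pairwise distinct requests $d$, every delivery scheme $S$ that is reliable under $d$ and every $\varepsilon>0$, $$\Pr_C\left[\frac{\ell_S(F,C,d)}F+\varepsilon<\frac{\ell_{\mathfrak F_o}(F,C,d)}F\right]\longrightarrow 0\qquad(F\to\infty).$$ -/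

import Mathlib

open Filter Topology
open scoped BigOperators

namespace CodedCaching

/-- The library: `N` files of `F` bits each. A bit is an element of `ZMod 2`, so that bitwise XOR is
addition. -/
abbrev Files (N F : ℕ) : Type := Fin N → Fin F → ZMod 2

/-- A cache configuration: `C k n` is the set of (positions of) bits of file `n` that user `k`
stores. -/
abbrev Caches (N K F : ℕ) : Type := Fin K → Fin N → Finset (Fin F)

/-- What user `k` finds in its cache: the values of the bits it has stored. -/
abbrev CacheContent {N K F : ℕ} (C : Caches N K F) (k : Fin K) : Type :=
  (n : Fin N) → {x : Fin F // x ∈ C k n} → ZMod 2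

/-- The content of the cache of user `k` when the library is `W`. -/
def cacheContent {N K F : ℕ} (C : Caches N K F) (k : Fin K) (W : Files N F) : CacheContent C k :=
  fun n x => W n x

/-- The possible outcomes of the random placement: user `k` stores `M k * F / N` bits (rounded down)
of every file. The random placement is the uniform distribution on this finite set, that is, all
the sets `C k n` are independent and uniform among the sets of the prescribed size. -/
noncomputable def placements (N K : ℕ) (M : Fin K → ℝ) (F : ℕ) : Finset (Caches N K F) :=
  {C | ∀ k n, (C k n).card = ⌊M k * F / N⌋₊}

/-- A delivery code for given caches `C` and requests `d`: the server broadcasts a signal of `len`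
bits computed from the library, and user `k` computes an estimate of file `d k` from the content of
its cache and from the signal. -/
structure DeliveryCode {N K F : ℕ} (C : Caches N K F) (d : Fin K → Fin N) where
  /-- number of broadcast bits -/
  len : ℕ
  /-- the server's encoder -/
  enc : Files N F → Fin len → ZMod 2
  /-- the users' decoders -/
  dec : (k : Fin K) → CacheContent C k → (Fin len → ZMod 2) → Fin F → ZMod 2

/-- A delivery scheme: a delivery code for every file size, all caches and all requests. -/
abbrev DeliveryScheme (N K : ℕ) : Type :=
  (F : ℕ) → (C : Caches N K F) → (d : Fin K → Fin N) → DeliveryCode C d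

/-- The output of the decoder of user `k` when the library is `W`. -/
def DeliveryCode.decoded {N K F : ℕ} {C : Caches N K F} {d : Fin K → Fin N}
    (c : DeliveryCode C d) (W : Files N F) (k : Fin K) : Fin F → ZMod 2 :=
  c.dec k (cacheContent C k W) (c.enc W)

/-- The load of a delivery code: the number of broadcast bits divided by the file size. -/
noncomputable def DeliveryCode.load {N K F : ℕ} {C : Caches N K F} {d : Fin K → Fin N}
    (c : DeliveryCode C d) : ℝ :=
  (c.len : ℝ) / F

namespace DeliveryScheme

variable {N K : ℕ}

/-- The probability that user `k` does not recover the requested file, for the random placement and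
independent uniform file bits. -/
noncomputable def errorProb (S : DeliveryScheme N K) (M : Fin K → ℝ) (d : Fin K → Fin N) (k : Fin K)
    (F : ℕ) : ℝ :=
  𝔼 C ∈ placements N K M F, 𝔼 W : Files N F,
    if (S F C d).decoded W k = W (d k) then (0 : ℝ) else 1

/-- Under the requests `d`, every user recovers its file with error probability tending to `0` as
the file size grows. -/
def ReliableUnder (S : DeliveryScheme N K) (M : Fin K → ℝ) (d : Fin K → Fin N) : Prop :=
  ∀ k, Tendsto (S.errorProb M d k) atTop (𝓝 0)

/-- Reliable for all requests. -/
def Reliable (S : DeliveryScheme N K) (M : Fin K → ℝ) : Prop :=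
  ∀ d, S.ReliableUnder M d

/-- The expected load under the requests `d`, for the random placement and file size `F`. -/
noncomputable def expectedLoad (S : DeliveryScheme N K) (M : Fin K → ℝ) (d : Fin K → Fin N)
    (F : ℕ) : ℝ :=
  𝔼 C ∈ placements N K M F, (S F C d).load

/-- The asymptotic load under the requests `d`. -/
noncomputable def loadUnder (S : DeliveryScheme N K) (M : Fin K → ℝ) (d : Fin K → Fin N) : EReal :=
  limsup (fun F : ℕ => (S.expectedLoad M d F : EReal)) atTop

/-- The worst-case load. -/
noncomputable def worstLoad (S : DeliveryScheme N K) (M : Fin K → ℝ) : EReal :=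
  ⨆ d : Fin K → Fin N, S.loadUnder M d

end DeliveryScheme

/-- The probability of an event that depends on the random placement. -/
noncomputable def placementProb (N K : ℕ) (M : Fin K → ℝ) (F : ℕ) (E : Caches N K F → Prop) : ℝ :=
  open Classical in 𝔼 C ∈ placements N K M F, if E C then (1 : ℝ) else 0

section ZeroPadding

variable {N K F : ℕ}

/-- The users that store bit `x` of file `n`. -/
def holders (C : Caches N K F) (n : Fin N) (x : Fin F) : Finset (Fin K) := {k | x ∈ C k n}

/-- The segment `W_{n,T}`: the bits of file `n` that are stored by the users in `T` and by no
others. -/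
def segment (C : Caches N K F) (n : Fin N) (T : Finset (Fin K)) : Finset (Fin F) :=
  {x | holders C n x = T}

/-- Bit number `r` of the segment `W_{n,T}` (in the order of the file), padded by zeros. -/
def paddedBit (C : Caches N K F) (W : Files N F) (n : Fin N) (T : Finset (Fin K)) (r : ℕ) : ZMod 2 :=
  if h : r < (segment C n T).card then W n ((segment C n T).orderEmbOfFin rfl ⟨r, h⟩) else 0

/-- The length of the longest segment `V_{k, U \ {k}}`, where `k` ranges over `U`. -/
def maxSize (C : Caches N K F) (d : Fin K → Fin N) (U : Finset (Fin K)) : ℕ :=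
  U.sup fun k => (segment C (d k) (U.erase k)).card

/-- The positions in the concatenation of the signals `X_U`: a set `U` of users and a position in
`X_U`. There are none for the empty set. -/
abbrev Position (C : Caches N K F) (d : Fin K → Fin N) : Type :=
  (U : Finset (Fin K)) × Fin (maxSize C d U)

/-- The signal of the zero-padding scheme: `X_U` is the XOR over `k ∈ U` of the segments
`V_{k, U \ {k}}`, padded by zeros to the length of the longest one. -/
def xorSignal (C : Caches N K F) (d : Fin K → Fin N) (W : Files N F) : Position C d → ZMod 2 :=
  fun p => ∑ k ∈ p.1, paddedBit C W (d k) (p.1.erase k) p.2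

/-- The library as user `k` knows it from its cache, unknown bits being replaced by `0`. -/
def known {C : Caches N K F} {k : Fin K} (Z : CacheContent C k) : Files N F :=
  fun n x => if h : x ∈ C k n then Z n ⟨x, h⟩ else 0

/-- Decoding in the zero-padding scheme. A cached bit is read from the cache. If bit `x` of file
`d k` is not cached by user `k` but by exactly the users in `T`, then it is read from the signal of
`U = T ∪ {k}`, after the other segments, all of them cached by user `k`, have been subtracted. -/
def xorDecode (C : Caches N K F) (d : Fin K → Fin N) (k : Fin K) (Z : CacheContent C k)
    (X : Position C d → ZMod 2) : Fin F → ZMod 2 := fun x =>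
  if h : x ∈ C k (d k) then Z (d k) ⟨x, h⟩
  else
    let T := holders C (d k) x
    let U := insert k T
    let r := ((segment C (d k) T).filter (· < x)).card
    (if hr : r < maxSize C d U then X ⟨U, ⟨r, hr⟩⟩ else 0)
      - ∑ j ∈ T, paddedBit C (known Z) (d j) (U.erase j) r

/-- The zero-padding XOR delivery scheme; the bits of all the signals `X_U` are sent one after
another (in an arbitrary order). -/
noncomputable def zeroPadding (N K : ℕ) : DeliveryScheme N K := fun _F C d =>
  { len := Fintype.card (Position C d)
    enc := fun W i => xorSignal C d W ((Fintype.equivFin (Position C d)).symm i)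
    dec := fun k Z X => xorDecode C d k Z fun p => X (Fintype.equivFin (Position C d) p) }

end ZeroPadding

end CodedCaching

/-! Index the signals by the non-empty sets `U` of users. Zero-padding spends `max_{k ∈ U} |V_{k, U
\ {k}}|` bits on `U`. The converse shows that for distinct requests a reliable scheme essentially
needs `|V_{m, U \ {m}}|` bits for each `U`, with `m = min U`; the two costs agree asymptotically.

Converse: reveal all bits that are not fresh. Going through the users in increasing order, each
cache is then known, so the signal determines every file (`eq_of_enc_eq`). Hence a signal shorter
than the number of fresh bits lets some user fail on at least half of the libraries
(`half_le_sum_error`). Sorting the fresh bits by requester and holders gives the sum over `U` above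
(`sum_card_fresh`).

Matching: by the second moment method every relative segment size concentrates at a product of
factors `M k / N` and `1 - M k / N` (`tendsto_expect_deviation`). Since `M` is monotone, this
product, over `k ∈ U`, is largest for `k = min U` (`segmentProb_erase_le`). So both bounds tend to
`loadLimit`. -/

namespace CodedCaching

/-! ### Correctness of zero-padding delivery -/

section Decoding

variable {N K F : ℕ}

lemma mem_segment {C : Caches N K F} {n : Fin N} {T : Finset (Fin K)} {x : Fin F} :
    x ∈ segment C n T ↔ ∀ k, x ∈ C k n ↔ k ∈ T := by
  simp [segment, holders, Finset.ext_iff]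

/-- Every bit of a segment with `k ∈ T` is in the cache of user `k`; this is what lets user `k`
subtract the interference in `X_U`. -/
lemma paddedBit_known (C : Caches N K F) (W : Files N F) {k : Fin K} (n : Fin N)
    {T : Finset (Fin K)} (hk : k ∈ T) (r : ℕ) :
    paddedBit C (known (cacheContent C k W)) n T r = paddedBit C W n T r := by
  unfold paddedBit
  split_ifs with h
  · have hx := mem_segment.1 (Finset.orderEmbOfFin_mem (segment C n T) rfl ⟨r, h⟩)
    simp only [known, cacheContent, dif_pos ((hx k).2 hk)]
  · rfl

lemma card_filter_lt_lt_card {α : Type*} [LinearOrder α] {s : Finset α} {x : α} (hx : x ∈ s) :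
    (s.filter (· < x)).card < s.card :=
  Finset.card_lt_card (Finset.filter_ssubset.2 ⟨x, hx, lt_irrefl x⟩)

/-- Identifies the index used by the decoder (the number of smaller elements) with the one used by
the encoder (the increasing enumeration). -/
lemma orderEmbOfFin_card_filter_lt {α : Type*} [LinearOrder α] {s : Finset α} {x : α}
    (hx : x ∈ s) :
    s.orderEmbOfFin rfl ⟨(s.filter (· < x)).card, card_filter_lt_lt_card hx⟩ = x := by
  obtain ⟨i, rfl⟩ : x ∈ Set.range (s.orderEmbOfFin rfl) := by
    rw [Finset.range_orderEmbOfFin]; exact hx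
  congr 1
  ext
  have : s.filter (· < s.orderEmbOfFin rfl i)
      = (Finset.Iio i).map (s.orderEmbOfFin rfl).toEmbedding := by
    ext y
    simp only [Finset.mem_filter, Finset.mem_map, Finset.mem_Iio]
    constructor
    · rintro ⟨hy, hlt⟩
      obtain ⟨j, rfl⟩ : y ∈ Set.range (s.orderEmbOfFin rfl) := by
        rw [Finset.range_orderEmbOfFin]; exact hy
      exact ⟨j, by simpa using hlt, rfl⟩
    · rintro ⟨j, hj, rfl⟩
      exact ⟨Finset.orderEmbOfFin_mem s rfl j, by simpa using hj⟩
  simp [this]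

lemma xorDecode_xorSignal (C : Caches N K F) (d : Fin K → Fin N) (W : Files N F) (k : Fin K) :
    xorDecode C d k (cacheContent C k W) (xorSignal C d W) = W (d k) := by
  funext x
  unfold xorDecode
  split_ifs with h
  · rfl
  have hx : x ∈ segment C (d k) (holders C (d k) x) := by simp [segment]
  have hk : k ∉ holders C (d k) x := by simpa [holders] using h
  have hlt := card_filter_lt_lt_card hx
  -- The segment of user `k` is one of those over which the maximum is taken, so the decoder's
  -- default value `0` never occurs.
  have hle : (segment C (d k) (holders C (d k) x)).card
      ≤ maxSize C d (insert k (holders C (d k) x)) := by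
    conv_lhs => rw [← Finset.erase_insert hk]
    exact Finset.le_sup (f := fun j =>
      (segment C (d j) ((insert k (holders C (d k) x)).erase j)).card)
      (Finset.mem_insert_self k (holders C (d k) x))
  have hbit : paddedBit C W (d k) (holders C (d k) x)
      ((segment C (d k) (holders C (d k) x)).filter (· < x)).card = W (d k) x := by
    rw [paddedBit, dif_pos hlt, orderEmbOfFin_card_filter_lt hx]
  simp only [dif_pos (hlt.trans_le hle), xorSignal]
  rw [Finset.sum_insert hk, Finset.erase_insert hk, hbit, add_sub_assoc, ← Finset.sum_sub_distrib,
    Finset.sum_eq_zero, add_zero]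
  intro j hj
  rw [paddedBit_known, sub_self]
  exact Finset.mem_erase.2 ⟨fun e => hk (e ▸ hj), Finset.mem_insert_self _ _⟩

lemma decoded_zeroPadding (C : Caches N K F) (d : Fin K → Fin N) (W : Files N F) (k : Fin K) :
    (zeroPadding N K F C d).decoded W k = W (d k) := by
  simpa [zeroPadding, DeliveryCode.decoded] using xorDecode_xorSignal C d W k

lemma load_zeroPadding (C : Caches N K F) (d : Fin K → Fin N) :
    (zeroPadding N K F C d).load = ∑ U : Finset (Fin K), (maxSize C d U : ℝ) / F := by
  simp [zeroPadding, DeliveryCode.load, Finset.sum_div]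

end Decoding

/-! ### Counting bound for arbitrary delivery codes -/

section Converse

variable {N K F : ℕ}

/-- The bits of the file requested by user `k` that none of the users up to `k` stores. -/
def fresh (C : Caches N K F) (d : Fin K → Fin N) (k : Fin K) : Finset (Fin F) :=
  {x | ∀ j ≤ k, x ∉ C j (d k)}

/-- The bits of the library that are fresh for the user requesting their file. -/
def freshBits (C : Caches N K F) (d : Fin K → Fin N) : Finset (Fin N × Fin F) :=
  Finset.univ.biUnion fun k => (fresh C d k).image (Prod.mk (d k))

lemma mem_freshBits {C : Caches N K F} {d : Fin K → Fin N} {p : Fin N × Fin F} :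
    p ∈ freshBits C d ↔ ∃ k, d k = p.1 ∧ ∀ j ≤ k, p.2 ∉ C j p.1 := by
  obtain ⟨n, x⟩ := p
  simp only [freshBits, fresh, Finset.mem_biUnion, Finset.mem_univ, true_and, Finset.mem_image,
    Finset.mem_filter, Prod.mk.injEq]
  constructor
  · rintro ⟨k, y, h, rfl, rfl⟩
    exact ⟨k, rfl, h⟩
  · rintro ⟨k, rfl, h⟩
    exact ⟨k, x, h, rfl, rfl⟩

lemma card_freshBits (C : Caches N K F) {d : Fin K → Fin N} (hd : d.Injective) :
    (freshBits C d).card = ∑ k, (fresh C d k).card := by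
  rw [freshBits, Finset.card_biUnion]
  · simp only [Finset.card_image_of_injective _ (Prod.mk_right_injective _)]
  · intro i _ j _ hij
    refine Finset.disjoint_left.2 fun p hp hp' => ?_
    rw [Finset.mem_image] at hp hp'
    obtain ⟨x, -, rfl⟩ := hp
    obtain ⟨y, -, h⟩ := hp'
    exact hij (hd (Prod.ext_iff.1 h).1.symm)

/-- Strong induction on the user. A bit cached by user `k` either lies in a file requested by some
`j < k`, on which the libraries already agree, or is not fresh: freshness for a requester `j ≥ k`
would forbid `k` to store it. -/
lemma eq_of_enc_eq {C : Caches N K F} {d : Fin K → Fin N}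
    (c : DeliveryCode C d) {W W' : Files N F} (hW : ∀ k, c.decoded W k = W (d k))
    (hW' : ∀ k, c.decoded W' k = W' (d k)) (henc : c.enc W = c.enc W')
    (hrest : ∀ p ∉ freshBits C d, W p.1 p.2 = W' p.1 p.2) : W = W' := by
  have key : ∀ k, W (d k) = W' (d k) := by
    intro k
    induction k using WellFoundedLT.induction with
    | ind k ih =>
      have hcache : cacheContent C k W = cacheContent C k W' := by
        funext n ⟨x, hx⟩
        simp only [cacheContent]
        by_cases hn : ∃ j < k, d j = n
        · obtain ⟨j, hj, rfl⟩ := hn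
          rw [ih j hj]
        · refine hrest (n, x) fun hp => ?_
          obtain ⟨j, hj, hjx⟩ := mem_freshBits.1 hp
          by_cases hjk : k ≤ j
          · exact hjx k hjk hx
          · exact hn ⟨j, not_le.1 hjk, hj⟩
      rw [← hW k, ← hW' k, DeliveryCode.decoded, DeliveryCode.decoded, hcache, henc]
  funext n x
  by_cases hn : ∃ k, d k = n
  · obtain ⟨k, rfl⟩ := hn
    rw [key k]
  · refine hrest (n, x) fun hp => ?_
    obtain ⟨k, hk, -⟩ := mem_freshBits.1 hp
    exact hn ⟨k, hk⟩

/-- The number of libraries that all users decode correctly is at most two to the power of the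
number of broadcast bits plus the number of bits that are not fresh. -/
lemma card_decoded_mul_le (C : Caches N K F) {d : Fin K → Fin N}
    (c : DeliveryCode C d) :
    (Finset.univ.filter fun W : Files N F => ∀ k, c.decoded W k = W (d k)).card
      * 2 ^ (freshBits C d).card ≤ 2 ^ c.len * Fintype.card (Files N F) := by
  let φ : Files N F → (Fin c.len → ZMod 2) × ({p // p ∉ freshBits C d} → ZMod 2) :=
    fun W => (c.enc W, fun p => W p.1.1 p.1.2)
  have hinj : Set.InjOn φ
      (Finset.univ.filter fun W : Files N F => ∀ k, c.decoded W k = W (d k)) := by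
    intro W hW W' hW' h
    simp only [Finset.coe_filter, Finset.mem_univ, true_and, Set.mem_ofPred_eq] at hW hW'
    refine eq_of_enc_eq c hW hW' (Prod.ext_iff.1 h).1 fun p hp => ?_
    exact congrFun (Prod.ext_iff.1 h).2 ⟨p, hp⟩
  have hcard := Finset.card_le_card_of_injOn φ (t := Finset.univ) (by simp) hinj
  have hsplit : Fintype.card {p // p ∉ freshBits C d} + (freshBits C d).card = N * F := by
    rw [Fintype.card_subtype_compl, Fintype.card_coe]
    have := Finset.card_le_univ (freshBits C d)
    simp only [Fintype.card_prod, Fintype.card_fin] at this ⊢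
    omega
  have hfiles : Fintype.card (Files N F) = 2 ^ (N * F) := by
    simp [Files, ZMod.card, ← pow_mul, mul_comm]
  rw [hfiles, ← hsplit]
  calc _ ≤ _ := Nat.mul_le_mul_right _ hcard
    _ = _ := by simp [ZMod.card, pow_add, mul_assoc]

/-- If fewer bits are broadcast than there are fresh bits, then some user fails with a
non-negligible probability. -/
lemma half_le_sum_error {C : Caches N K F} {d : Fin K → Fin N} (hd : d.Injective)
    (c : DeliveryCode C d) (hlen : c.len < ∑ k, (fresh C d k).card) :
    (1 : ℝ) / 2 ≤ ∑ k, 𝔼 W : Files N F, if c.decoded W k = W (d k) then (0 : ℝ) else 1 := by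
  classical
  have hgood : (𝔼 W : Files N F, if ∀ k, c.decoded W k = W (d k) then (1 : ℝ) else 0) ≤ 1 / 2 := by
    rw [Finset.expect_eq_sum_div_card, Finset.sum_boole, Finset.card_univ,
      div_le_div_iff₀ (by exact_mod_cast Fintype.card_pos) two_pos, one_mul]
    have h := card_decoded_mul_le C c
    rw [card_freshBits C hd] at h
    -- One missing bit already costs a factor of two, whence the constant `1 / 2`.
    have h2 : 2 ^ c.len * 2 ≤ 2 ^ ∑ k, (fresh C d k).card := by
      rw [← pow_succ]; exact Nat.pow_le_pow_right two_pos hlen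
    have : 2 ^ c.len * ((Finset.univ.filter fun W : Files N F =>
        ∀ k, c.decoded W k = W (d k)).card * 2) ≤ 2 ^ c.len * Fintype.card (Files N F) := by
      calc _ = (Finset.univ.filter fun W : Files N F =>
        ∀ k, c.decoded W k = W (d k)).card * (2 ^ c.len * 2) := by ring
        _ ≤ _ := Nat.mul_le_mul_left _ h2
        _ ≤ _ := h
    exact_mod_cast Nat.le_of_mul_le_mul_left this (by positivity)
  -- Union bound over the users.
  have hunion : (1 : ℝ) - (𝔼 W : Files N F, if ∀ k, c.decoded W k = W (d k) then (1 : ℝ) else 0)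
      ≤ ∑ k, 𝔼 W : Files N F, if c.decoded W k = W (d k) then (0 : ℝ) else 1 := by
    rw [← Finset.expect_sum_comm, ← Finset.expect_const (Finset.univ_nonempty (α := Files N F))
      (1 : ℝ), ← Finset.expect_sub_distrib]
    refine Finset.expect_le_expect fun W _ => ?_
    have hnn : ∀ k ∈ Finset.univ, (0 : ℝ) ≤ if c.decoded W k = W (d k) then (0 : ℝ) else 1 := by
      intro k _; split_ifs <;> norm_num
    split_ifs with h
    · simpa using Finset.sum_nonneg hnn
    · push Not at h
      obtain ⟨k, hk⟩ := h
      simpa [hk] using Finset.single_le_sum hnn (Finset.mem_univ k)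
  linarith

/-- A bit is fresh for `k` exactly when all its holders come after `k`. -/
lemma card_fresh (C : Caches N K F) (d : Fin K → Fin N) (k : Fin K) :
    (fresh C d k).card = ∑ T ∈ (Finset.Ioi k).powerset, (segment C (d k) T).card := by
  rw [← Finset.card_biUnion]
  · congr 1
    ext x
    simp only [fresh, Finset.mem_filter, Finset.mem_univ, true_and, Finset.mem_biUnion,
      Finset.mem_powerset]
    constructor
    · intro h
      refine ⟨holders C (d k) x, fun j hj => ?_, by simp [segment]⟩
      rw [Finset.mem_Ioi]
      by_contra hjk
      exact h j (not_lt.1 hjk) (by simpa [holders] using hj)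
    · rintro ⟨T, hT, hx⟩ j hj hjx
      exact absurd (Finset.mem_Ioi.1 (hT ((mem_segment.1 hx j).1 hjx))) (not_lt.2 hj)
  · intro T _ T' _ hne
    refine Finset.disjoint_left.2 fun x hx hx' => ?_
    simp only [segment, Finset.mem_filter, Finset.mem_univ, true_and] at hx hx'
    exact hne (hx.symm.trans hx')

/-- The fresh bits of all users, sorted by the set consisting of the requesting user and of the
users that store the bit. -/
lemma sum_card_fresh (C : Caches N K F) (d : Fin K → Fin N) :
    ∑ k, (fresh C d k).card = ∑ U : {U : Finset (Fin K) // U.Nonempty},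
      (segment C (d (U.1.min' U.2)) (U.1.erase (U.1.min' U.2))).card := by
  simp_rw [card_fresh]
  rw [Finset.sum_sigma']
  -- A pair `(k, T)` with `T` after `k` is the same as the set `U = insert k T`, from which `k` is
  -- recovered as the minimum.
  have hmin : ∀ (k : Fin K) (T : Finset (Fin K)), T ⊆ Finset.Ioi k → ∀ h : (insert k T).Nonempty,
      (insert k T).min' h = k := by
    intro k T hT h
    refine le_antisymm (Finset.min'_le _ _ (Finset.mem_insert_self _ _))
      (Finset.le_min' _ _ _ fun j hj => ?_)
    rcases Finset.mem_insert.1 hj with rfl | hj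
    · exact le_rfl
    · exact (Finset.mem_Ioi.1 (hT hj)).le
  have hnot : ∀ (k : Fin K) (T : Finset (Fin K)), T ⊆ Finset.Ioi k → k ∉ T :=
    fun k T hT h => lt_irrefl k (Finset.mem_Ioi.1 (hT h))
  refine Finset.sum_bij' (fun p _ => ⟨insert p.1 p.2, Finset.insert_nonempty _ _⟩)
    (fun U _ => ⟨U.1.min' U.2, U.1.erase (U.1.min' U.2)⟩) (by simp) ?_ ?_ ?_ ?_
  · intro U _
    simp only [Finset.mem_sigma, Finset.mem_univ, true_and, Finset.mem_powerset]
    intro j hj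
    rw [Finset.mem_Ioi]
    exact Finset.min'_lt_of_mem_erase_min' _ U.2 hj
  · rintro ⟨k, T⟩ h
    simp only [Finset.mem_sigma, Finset.mem_univ, true_and, Finset.mem_powerset] at h
    simp only [hmin k T h, Finset.erase_insert (hnot k T h)]
  · intro U _
    exact Subtype.ext (Finset.insert_erase (Finset.min'_mem _ U.2))
  · rintro ⟨k, T⟩ h
    simp only [Finset.mem_sigma, Finset.mem_univ, true_and, Finset.mem_powerset] at h
    simp only [hmin k T h, Finset.erase_insert (hnot k T h)]

end Converse

/-! ### One- and two-point probabilities of a uniform subset of fixed size -/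

section UniformSubset

lemma expect_prod_piFinset {ι : Type*} [Fintype ι] [DecidableEq ι] {α : ι → Type*}
    (t : ∀ i, Finset (α i)) (f : ∀ i, α i → ℝ) :
    𝔼 x ∈ Fintype.piFinset t, ∏ i, f i (x i) = ∏ i, 𝔼 a ∈ t i, f i a := by
  simp only [Finset.expect_eq_sum_div_card, Finset.prod_div_distrib, Finset.prod_univ_sum,
    Fintype.card_piFinset, Nat.cast_prod]

/-- Marginals of a product distribution: the product formula with factor `1` at every other index.
-/
lemma expect_piFinset_apply {ι : Type*} [Fintype ι] [DecidableEq ι] {α : ι → Type*}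
    {t : ∀ i, Finset (α i)} (ht : ∀ i, (t i).Nonempty) (i : ι) (f : α i → ℝ) :
    𝔼 x ∈ Fintype.piFinset t, f (x i) = 𝔼 a ∈ t i, f a := by
  have h := expect_prod_piFinset t fun j a => if h : j = i then f (h ▸ a) else 1
  rw [Fintype.prod_eq_single i fun j hj => by simp [hj, Finset.expect_const (ht j)]] at h
  simp only [dite_true] at h
  rw [← h]
  refine Finset.expect_congr rfl fun x _ => ?_
  rw [Fintype.prod_eq_single i fun j hj => by simp [hj]]
  simp

variable {F m : ℕ}

/-- The probability that a uniformly random set of `m` of the `F` positions avoids a given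
position. -/
noncomputable def avoidOne (F m : ℕ) : ℝ := ((F : ℝ) - m) / F

/-- The probability that a uniformly random set of `m` of the `F` positions avoids two given
positions. -/
noncomputable def avoidTwo (F m : ℕ) : ℝ := avoidOne F m * (((F : ℝ) - m - 1) / (F - 1))

lemma card_powersetCard_avoiding (A : Finset (Fin F)) :
    ((Finset.powersetCard m (Finset.univ : Finset (Fin F))).filter (Disjoint A)).card
      = (F - A.card).choose m := by
  have : (Finset.powersetCard m (Finset.univ : Finset (Fin F))).filter (Disjoint A)
      = Finset.powersetCard m Aᶜ := by
    ext s
    simp [Finset.mem_powersetCard, Finset.subset_compl_iff_disjoint_left, and_comm]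
  rw [this, Finset.card_powersetCard, Finset.card_compl, Fintype.card_fin]

lemma cast_choose_pred_mul {n : ℕ} (hmn : m ≤ n + 1) :
    (n.choose m : ℝ) * (n + 1) = (n + 1).choose m * ((n : ℝ) + 1 - m) := by
  have h := Nat.choose_mul_succ_eq n m
  have h' : ((n + 1 - m : ℕ) : ℝ) = (n : ℝ) + 1 - m := by push_cast [Nat.cast_sub hmn]; ring
  rw [← h']
  exact_mod_cast h

lemma expect_avoidOne (hm : m ≤ F) (x : Fin F) :
    (𝔼 s ∈ Finset.powersetCard m (Finset.univ : Finset (Fin F)), if x ∉ s then (1 : ℝ) else 0)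
      = avoidOne F m := by
  have h := card_powersetCard_avoiding (m := m) {x}
  simp only [Finset.disjoint_singleton_left, Finset.card_singleton] at h
  rw [Finset.expect_eq_sum_div_card, Finset.sum_boole, h, Finset.card_powersetCard,
    Finset.card_univ, Fintype.card_fin, avoidOne]
  obtain ⟨n, rfl⟩ : ∃ n, F = n + 1 := ⟨F - 1, by have := x.pos; omega⟩
  have hpos : (0 : ℝ) < (n + 1).choose m := by exact_mod_cast Nat.choose_pos hm
  rw [div_eq_div_iff hpos.ne' (by positivity)]
  simpa [mul_comm] using cast_choose_pred_mul hm

lemma expect_avoidTwo (hm : m ≤ F) {x y : Fin F} (hxy : x ≠ y) :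
    (𝔼 s ∈ Finset.powersetCard m (Finset.univ : Finset (Fin F)),
      if x ∉ s ∧ y ∉ s then (1 : ℝ) else 0) = avoidTwo F m := by
  have h := card_powersetCard_avoiding (m := m) {x, y}
  simp only [Finset.disjoint_insert_left, Finset.disjoint_singleton_left,
    Finset.card_pair hxy] at h
  rw [Finset.expect_eq_sum_div_card, Finset.sum_boole, h, Finset.card_powersetCard,
    Finset.card_univ, Fintype.card_fin, avoidTwo, avoidOne]
  obtain ⟨n, rfl⟩ : ∃ n, F = n + 2 := ⟨F - 2, by
    have := x.2; have := y.2; have := Fin.val_ne_of_ne hxy; omega⟩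
  have hpos : (0 : ℝ) < (n + 2).choose m := by exact_mod_cast Nat.choose_pos hm
  have h1 := cast_choose_pred_mul (n := n + 1) hm
  -- The recursion for binomials needs `m ≤ n + 1`; for `m = n + 2` both binomials vanish.
  have h2 : (n.choose m : ℝ) * (n + 1) = (n + 1).choose m * ((n : ℝ) + 1 - m) := by
    rcases hm.lt_or_eq with hlt | rfl
    · exact cast_choose_pred_mul (by omega)
    · simp [Nat.choose_eq_zero_of_lt]
  push_cast at h1 ⊢
  have hn : (n : ℝ) + 2 - 1 ≠ 0 := by ring_nf; positivity
  rw [div_mul_div_comm, div_eq_div_iff hpos.ne' (by positivity)]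
  linear_combination (n + 2 : ℝ) * h2 + ((n : ℝ) + 1 - m) * h1

/-- The probability that a given position belongs to a uniformly random set of `m` of the `F`
positions (if `b` holds) or does not (otherwise). -/
noncomputable def oneProb (F m : ℕ) (b : Prop) [Decidable b] : ℝ :=
  if b then 1 - avoidOne F m else avoidOne F m

/-- The probability that two given positions both belong to a uniformly random set of `m` of the
`F` positions (if `b` holds) or both do not (otherwise). -/
noncomputable def twoProb (F m : ℕ) (b : Prop) [Decidable b] : ℝ :=
  if b then 1 - 2 * avoidOne F m + avoidTwo F m else avoidTwo F m

lemma powersetCard_univ_nonempty (hm : m ≤ F) :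
    (Finset.powersetCard m (Finset.univ : Finset (Fin F))).Nonempty :=
  Finset.powersetCard_nonempty.2 (by simpa using hm)

lemma expect_mem_iff (hm : m ≤ F) (b : Prop) [Decidable b] (x : Fin F) :
    (𝔼 s ∈ Finset.powersetCard m (Finset.univ : Finset (Fin F)),
      if (x ∈ s ↔ b) then (1 : ℝ) else 0) = oneProb F m b := by
  have hne := powersetCard_univ_nonempty hm
  by_cases hb : b
  · simp only [oneProb, if_true, iff_true, hb]
    rw [← expect_avoidOne hm x]
    nth_rewrite 2 [← Finset.expect_const hne (1 : ℝ)]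
    rw [← Finset.expect_sub_distrib]
    refine Finset.expect_congr rfl fun s _ => ?_
    split_ifs <;> simp_all
  · simp only [oneProb, if_false, iff_false, hb]
    exact expect_avoidOne hm x

/-- Inclusion–exclusion reduces joint membership to joint avoidance. -/
lemma expect_mem_iff_and (hm : m ≤ F) (b : Prop) [Decidable b] {x y : Fin F} (hxy : x ≠ y) :
    (𝔼 s ∈ Finset.powersetCard m (Finset.univ : Finset (Fin F)),
      if (x ∈ s ↔ b) ∧ (y ∈ s ↔ b) then (1 : ℝ) else 0) = twoProb F m b := by
  have hne := powersetCard_univ_nonempty hm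
  by_cases hb : b
  · simp only [twoProb, if_true, iff_true, hb]
    rw [two_mul, ← expect_avoidTwo hm hxy]
    nth_rewrite 1 [← expect_avoidOne hm x]
    rw [← expect_avoidOne hm y, ← Finset.expect_add_distrib]
    nth_rewrite 2 [← Finset.expect_const hne (1 : ℝ)]
    rw [← Finset.expect_sub_distrib, ← Finset.expect_add_distrib]
    refine Finset.expect_congr rfl fun s _ => ?_
    by_cases h1 : x ∈ s <;> by_cases h2 : y ∈ s <;> simp [h1, h2]
  · simp only [twoProb, if_false, iff_false, hb]
    exact expect_avoidTwo hm hxy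

variable {p : ℝ} {μ : ℕ → ℕ}

lemma tendsto_avoidOne (hμ : Tendsto (fun F => (μ F : ℝ) / F) atTop (𝓝 p)) :
    Tendsto (fun F => avoidOne F (μ F)) atTop (𝓝 (1 - p)) := by
  refine (hμ.const_sub 1).congr' ?_
  filter_upwards [eventually_gt_atTop 0] with F hF
  have : (F : ℝ) ≠ 0 := by positivity
  rw [avoidOne, sub_div, div_self this]

/-- Fixing the size makes the positions dependent, but only through corrections of order `1 / F`. -/
lemma tendsto_avoidTwo (hμ : Tendsto (fun F => (μ F : ℝ) / F) atTop (𝓝 p)) :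
    Tendsto (fun F => avoidTwo F (μ F)) atTop (𝓝 ((1 - p) ^ 2)) := by
  rw [sq]
  refine (tendsto_avoidOne hμ).mul ?_
  have hinv : Tendsto (fun F : ℕ => (1 : ℝ) / F) atTop (𝓝 0) := tendsto_one_div_atTop_nhds_zero_nat
  have h := ((hμ.const_sub 1).sub hinv).div (hinv.const_sub 1) (by norm_num)
  simp only [sub_zero, div_one] at h
  refine h.congr' ?_
  filter_upwards [eventually_gt_atTop 1] with F hF
  have h0 : (F : ℝ) ≠ 0 := by positivity
  have h1 : (F : ℝ) - 1 ≠ 0 := sub_ne_zero.2 (by exact_mod_cast hF.ne')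
  simp only [Pi.div_apply]
  field_simp

lemma tendsto_oneProb (hμ : Tendsto (fun F => (μ F : ℝ) / F) atTop (𝓝 p)) (b : Prop)
    [Decidable b] :
    Tendsto (fun F => oneProb F (μ F) b) atTop (𝓝 (if b then p else 1 - p)) := by
  unfold oneProb
  split_ifs
  · simpa using (tendsto_avoidOne hμ).const_sub 1
  · exact tendsto_avoidOne hμ

lemma tendsto_twoProb (hμ : Tendsto (fun F => (μ F : ℝ) / F) atTop (𝓝 p)) (b : Prop)
    [Decidable b] :
    Tendsto (fun F => twoProb F (μ F) b) atTop (𝓝 ((if b then p else 1 - p) ^ 2)) := by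
  unfold twoProb
  split_ifs
  · have h := (((tendsto_avoidOne hμ).const_mul 2).const_sub 1).add (tendsto_avoidTwo hμ)
    convert h using 2
    ring
  · exact tendsto_avoidTwo hμ

end UniformSubset

/-! ### Concentration of the segment sizes -/

section Concentration

variable {N K : ℕ} {M : Fin K → ℝ}

lemma placements_eq_piFinset (N K : ℕ) (M : Fin K → ℝ) (F : ℕ) :
    placements N K M F = Fintype.piFinset fun k => Fintype.piFinset fun _ =>
      Finset.powersetCard ⌊M k * F / N⌋₊ Finset.univ := by
  ext C
  simp [placements, Finset.mem_powersetCard]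

lemma floor_le_fileSize (hM : ∀ k, 0 ≤ M k ∧ M k ≤ N) (F : ℕ) (k : Fin K) :
    ⌊M k * F / N⌋₊ ≤ F := by
  refine Nat.floor_le_of_le ?_
  refine div_le_of_le_mul₀ (by positivity) (by positivity) ?_
  rw [mul_comm (F : ℝ)]
  gcongr
  exact (hM k).2

lemma placements_nonempty (hM : ∀ k, 0 ≤ M k ∧ M k ≤ N) (F : ℕ) :
    (placements N K M F).Nonempty := by
  rw [placements_eq_piFinset]
  exact Fintype.piFinset_nonempty.2 fun k => Fintype.piFinset_nonempty.2 fun _ =>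
    powersetCard_univ_nonempty (floor_le_fileSize hM F k)

lemma tendsto_floor_div (hM : ∀ k, 0 ≤ M k ∧ M k ≤ N) (k : Fin K) :
    Tendsto (fun F : ℕ => (⌊M k * F / N⌋₊ : ℝ) / F) atTop (𝓝 (M k / N)) := by
  have h := (tendsto_nat_floor_mul_div_atTop (R := ℝ) (a := M k / N)
    (div_nonneg (hM k).1 (Nat.cast_nonneg N))).comp tendsto_natCast_atTop_atTop
  refine h.congr fun F => ?_
  simp [div_mul_eq_mul_div]

/-- Independence across users; the sets chosen for the other files integrate out. -/
lemma expect_placements_prod (hM : ∀ k, 0 ≤ M k ∧ M k ≤ N) (F : ℕ) (n : Fin N)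
    (f : Fin K → Finset (Fin F) → ℝ) :
    𝔼 C ∈ placements N K M F, ∏ k, f k (C k n)
      = ∏ k, 𝔼 s ∈ Finset.powersetCard ⌊M k * F / N⌋₊ (Finset.univ : Finset (Fin F)), f k s := by
  rw [placements_eq_piFinset, expect_prod_piFinset (fun k => Fintype.piFinset fun _ =>
      Finset.powersetCard ⌊M k * F / N⌋₊ Finset.univ) fun k c => f k (c n)]
  refine Finset.prod_congr rfl fun k _ => ?_
  exact expect_piFinset_apply (fun _ => powersetCard_univ_nonempty (floor_le_fileSize hM F k)) n _

lemma expect_mem_segment (hM : ∀ k, 0 ≤ M k ∧ M k ≤ N) {F : ℕ} (n : Fin N)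
    (T : Finset (Fin K)) (x : Fin F) :
    (𝔼 C ∈ placements N K M F, if x ∈ segment C n T then (1 : ℝ) else 0)
      = ∏ k, oneProb F ⌊M k * F / N⌋₊ (k ∈ T) := by
  simp_rw [← expect_mem_iff (floor_le_fileSize hM F _) _ x]
  rw [← expect_placements_prod hM F n]
  refine Finset.expect_congr rfl fun C _ => ?_
  rw [Fintype.prod_ite_zero]
  simp [mem_segment]

lemma expect_mem_segment_and (hM : ∀ k, 0 ≤ M k ∧ M k ≤ N) {F : ℕ} (n : Fin N)
    (T : Finset (Fin K)) {x y : Fin F} (hxy : x ≠ y) :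
    (𝔼 C ∈ placements N K M F, if x ∈ segment C n T ∧ y ∈ segment C n T then (1 : ℝ) else 0)
      = ∏ k, twoProb F ⌊M k * F / N⌋₊ (k ∈ T) := by
  simp_rw [← expect_mem_iff_and (floor_le_fileSize hM F _) _ hxy]
  rw [← expect_placements_prod hM F n]
  refine Finset.expect_congr rfl fun C _ => ?_
  rw [Fintype.prod_ite_zero]
  simp [mem_segment, forall_and]

lemma cast_card_segment {F : ℕ} (C : Caches N K F) (n : Fin N) (T : Finset (Fin K)) :
    ((segment C n T).card : ℝ) = ∑ x, if x ∈ segment C n T then (1 : ℝ) else 0 := by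
  simp

lemma expect_card_segment (hM : ∀ k, 0 ≤ M k ∧ M k ≤ N) (F : ℕ) (n : Fin N)
    (T : Finset (Fin K)) :
    (𝔼 C ∈ placements N K M F, ((segment C n T).card : ℝ))
      = F * ∏ k, oneProb F ⌊M k * F / N⌋₊ (k ∈ T) := by
  simp_rw [cast_card_segment, Finset.expect_sum_comm, expect_mem_segment hM]
  simp

lemma expect_card_segment_sq (hM : ∀ k, 0 ≤ M k ∧ M k ≤ N) (F : ℕ) (n : Fin N)
    (T : Finset (Fin K)) :
    (𝔼 C ∈ placements N K M F, ((segment C n T).card : ℝ) ^ 2)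
      = F * ∏ k, oneProb F ⌊M k * F / N⌋₊ (k ∈ T)
        + (F ^ 2 - F) * ∏ k, twoProb F ⌊M k * F / N⌋₊ (k ∈ T) := by
  have hsq : ∀ C : Caches N K F, ((segment C n T).card : ℝ) ^ 2 = ∑ x, ∑ y,
      if x ∈ segment C n T ∧ y ∈ segment C n T then (1 : ℝ) else 0 := by
    intro C
    rw [sq, cast_card_segment, Finset.sum_mul_sum]
    simp only [ite_and, ite_mul, one_mul, zero_mul]
  -- The diagonal is written as a correction to the off-diagonal value, so that the double sum is
  -- immediate.
  have hxy : ∀ x y : Fin F, (𝔼 C ∈ placements N K M F,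
      if x ∈ segment C n T ∧ y ∈ segment C n T then (1 : ℝ) else 0)
      = (if x = y then (∏ k, oneProb F ⌊M k * F / N⌋₊ (k ∈ T))
          - ∏ k, twoProb F ⌊M k * F / N⌋₊ (k ∈ T) else 0)
        + ∏ k, twoProb F ⌊M k * F / N⌋₊ (k ∈ T) := by
    intro x y
    split_ifs with h
    · subst h
      simp only [and_self]
      rw [expect_mem_segment hM]
      ring
    · rw [expect_mem_segment_and hM n T h, zero_add]
  simp_rw [hsq, Finset.expect_sum_comm, hxy, Finset.sum_add_distrib]
  simp
  ring

/-- The limit of the fraction of the bits of a file that are stored by exactly the users in `T`. -/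
noncomputable def segmentProb (N : ℕ) (M : Fin K → ℝ) (T : Finset (Fin K)) : ℝ :=
  ∏ k, if k ∈ T then M k / N else 1 - M k / N

/-- The two-point probability tends to the square of the limiting one-point probability and the
diagonal contributes `O(1 / F)`, so the terms of the expanded square cancel. -/
lemma tendsto_expect_sq_deviation (hM : ∀ k, 0 ≤ M k ∧ M k ≤ N) (n : Fin N)
    (T : Finset (Fin K)) :
    Tendsto (fun F => 𝔼 C ∈ placements N K M F,
      (((segment C n T).card : ℝ) / F - segmentProb N M T) ^ 2) atTop (𝓝 0) := by
  have h1 : Tendsto (fun F : ℕ => ∏ k, oneProb F ⌊M k * F / N⌋₊ (k ∈ T)) atTop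
      (𝓝 (segmentProb N M T)) :=
    tendsto_finsetProd _ fun k _ => tendsto_oneProb (tendsto_floor_div hM k) _
  have h2 : Tendsto (fun F : ℕ => ∏ k, twoProb F ⌊M k * F / N⌋₊ (k ∈ T)) atTop
      (𝓝 (segmentProb N M T ^ 2)) := by
    rw [segmentProb, ← Finset.prod_pow]
    exact tendsto_finsetProd _ fun k _ => tendsto_twoProb (tendsto_floor_div hM k) _
  have hinv : Tendsto (fun F : ℕ => (1 : ℝ) / F) atTop (𝓝 0) := tendsto_one_div_atTop_nhds_zero_nat
  have h := (((hinv.mul h1).add ((hinv.const_sub 1).mul h2)).sub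
    (h1.const_mul (2 * segmentProb N M T))).add_const (segmentProb N M T ^ 2)
  have hlim : 0 * segmentProb N M T + (1 - 0) * segmentProb N M T ^ 2
      - 2 * segmentProb N M T * segmentProb N M T + segmentProb N M T ^ 2 = 0 := by ring
  rw [hlim] at h
  refine h.congr' ?_
  filter_upwards [eventually_gt_atTop 0] with F hF
  have hF' : (F : ℝ) ≠ 0 := by positivity
  have hexp : ∀ C : Caches N K F, (((segment C n T).card : ℝ) / F - segmentProb N M T) ^ 2
      = ((segment C n T).card : ℝ) ^ 2 / F ^ 2
        - 2 * segmentProb N M T / F * ((segment C n T).card : ℝ) + segmentProb N M T ^ 2 :=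
    fun C => by ring
  simp_rw [hexp, Finset.expect_add_distrib, Finset.expect_sub_distrib, ← Finset.expect_div,
    ← Finset.mul_expect, Finset.expect_const (placements_nonempty hM F),
    expect_card_segment_sq hM, expect_card_segment hM]
  field_simp

/-- The total deviation of the relative segment sizes from their limits. -/
noncomputable def deviation {F : ℕ} (M : Fin K → ℝ) (C : Caches N K F) : ℝ :=
  ∑ n, ∑ T, |((segment C n T).card : ℝ) / F - segmentProb N M T|

lemma abs_sub_le_deviation {F : ℕ} (C : Caches N K F) (n : Fin N) (T : Finset (Fin K)) :
    |((segment C n T).card : ℝ) / F - segmentProb N M T| ≤ deviation M C := by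
  refine (Finset.single_le_sum (f := fun T =>
    |((segment C n T).card : ℝ) / F - segmentProb N M T|) (fun _ _ => abs_nonneg _)
    (Finset.mem_univ T)).trans ?_
  exact Finset.single_le_sum (f := fun n => ∑ T,
    |((segment C n T).card : ℝ) / F - segmentProb N M T|)
    (fun _ _ => Finset.sum_nonneg fun _ _ => abs_nonneg _) (Finset.mem_univ n)

lemma deviation_nonneg {F : ℕ} (C : Caches N K F) : 0 ≤ deviation M C :=
  Finset.sum_nonneg fun _ _ => Finset.sum_nonneg fun _ _ => abs_nonneg _

lemma tendsto_expect_deviation (hM : ∀ k, 0 ≤ M k ∧ M k ≤ N) :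
    Tendsto (fun F => 𝔼 C ∈ placements N K M F, deviation M C) atTop (𝓝 0) := by
  simp_rw [deviation, Finset.expect_sum_comm]
  rw [← Finset.sum_const_zero (s := (Finset.univ : Finset (Fin N)))]
  refine tendsto_finsetSum _ fun n _ => ?_
  rw [← Finset.sum_const_zero (s := (Finset.univ : Finset (Finset (Fin K))))]
  refine tendsto_finsetSum _ fun T _ => ?_
  have h := (tendsto_expect_sq_deviation hM n T).sqrt
  rw [Real.sqrt_zero] at h
  refine squeeze_zero (fun F => Finset.expect_nonneg fun _ _ => abs_nonneg _) (fun F => ?_) h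
  refine Real.le_sqrt_of_sq_le ?_
  -- Cauchy–Schwarz against the constant `1` passes from the second to the first absolute moment.
  have hcs := Finset.expect_mul_sq_le_sq_mul_sq (placements N K M F)
    (fun C => |((segment C n T).card : ℝ) / F - segmentProb N M T|) fun _ => 1
  simpa [Finset.expect_const (placements_nonempty hM F)] using hcs

end Concentration

/-! ### Matching the two bounds -/

section Comparison

variable {N K : ℕ} {M : Fin K → ℝ}

/-- The products differ only at `m` and `k`. With `p j = M j / N`, the claim is `p m * (1 - p k) ≤
(1 - p m) * p k`, that is, `p m ≤ p k`. -/
lemma segmentProb_erase_le (hM : ∀ k, 0 ≤ M k ∧ M k ≤ N) (hmono : Monotone M)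
    {U : Finset (Fin K)} {m k : Fin K} (hm : m ∈ U) (hk : k ∈ U) (hmk : m ≤ k) :
    segmentProb N M (U.erase k) ≤ segmentProb N M (U.erase m) := by
  rcases hmk.eq_or_lt with rfl | hlt
  · exact le_rfl
  unfold segmentProb
  rw [← Finset.prod_mul_prod_compl {m, k}, ← Finset.prod_mul_prod_compl {m, k} fun j =>
    if j ∈ U.erase m then M j / N else 1 - M j / N, Finset.prod_pair hlt.ne,
    Finset.prod_pair hlt.ne]
  have hrest : ∏ j ∈ ({m, k} : Finset (Fin K))ᶜ, (if j ∈ U.erase k then M j / N else 1 - M j / N)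
      = ∏ j ∈ ({m, k} : Finset (Fin K))ᶜ, (if j ∈ U.erase m then M j / N else 1 - M j / N) := by
    refine Finset.prod_congr rfl fun j hj => ?_
    simp only [Finset.mem_compl, Finset.mem_insert, Finset.mem_singleton, not_or] at hj
    simp [hj.1, hj.2]
  rw [hrest]
  refine mul_le_mul_of_nonneg_right ?_ (Finset.prod_nonneg fun j _ => ?_)
  · have : M m / N ≤ M k / N := div_le_div_of_nonneg_right (hmono hmk) (Nat.cast_nonneg N)
    simp only [Finset.mem_erase, hm, hk, hlt.ne, hlt.ne', ne_eq, not_false_eq_true, not_true,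
      and_true, if_true, if_false]
    linarith
  · split_ifs
    · exact div_nonneg (hM j).1 (Nat.cast_nonneg N)
    · exact sub_nonneg.2 (div_le_one_of_le₀ (hM j).2 (Nat.cast_nonneg N))

/-- The non-empty sets of users. -/
abbrev UserSets (K : ℕ) : Type := {U : Finset (Fin K) // U.Nonempty}

/-- The limit of the length of the signal `X_U` of the zero-padding scheme, divided by the file
size. -/
noncomputable def signalLimit (N : ℕ) (M : Fin K → ℝ) (U : UserSets K) : ℝ :=
  segmentProb N M (U.1.erase (U.1.min' U.2))

lemma maxSize_div_le (hM : ∀ k, 0 ≤ M k ∧ M k ≤ N) (hmono : Monotone M) {F : ℕ}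
    (C : Caches N K F) (d : Fin K → Fin N) (U : UserSets K) :
    (maxSize C d U.1 : ℝ) / F ≤ signalLimit N M U + deviation M C := by
  obtain ⟨k, hk, h⟩ := Finset.exists_mem_eq_sup U.1 U.2
    fun k => (segment C (d k) (U.1.erase k)).card
  have h1 := (abs_le.1 (abs_sub_le_deviation (M := M) C (d k) (U.1.erase k))).2
  have h2 := segmentProb_erase_le hM hmono (U.1.min'_mem U.2) hk (U.1.min'_le k hk)
  rw [maxSize, h, signalLimit]
  linarith

lemma signalLimit_sub_deviation_le {F : ℕ} (C : Caches N K F) (d : Fin K → Fin N)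
    (U : UserSets K) :
    signalLimit N M U - deviation M C
      ≤ ((segment C (d (U.1.min' U.2)) (U.1.erase (U.1.min' U.2))).card : ℝ) / F := by
  have h := (abs_le.1 (abs_sub_le_deviation (M := M) C (d (U.1.min' U.2))
    (U.1.erase (U.1.min' U.2)))).1
  rw [signalLimit]
  linarith

lemma load_zeroPadding_eq_sum_userSets {F : ℕ} (C : Caches N K F) (d : Fin K → Fin N) :
    (zeroPadding N K F C d).load = ∑ U : UserSets K, (maxSize C d U.1 : ℝ) / F := by
  rw [load_zeroPadding, ← Finset.sum_subtype (Finset.univ.filter Finset.Nonempty) (by simp)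
    fun U => (maxSize C d U : ℝ) / F]
  refine (Finset.sum_filter_of_ne fun U _ h => ?_).symm
  by_contra hU
  rw [Finset.not_nonempty_iff_eq_empty] at hU
  simp [hU, maxSize] at h

/-- The limit of the load of the zero-padding scheme. -/
noncomputable def loadLimit (N : ℕ) (M : Fin K → ℝ) : ℝ := ∑ U : UserSets K, signalLimit N M U

lemma load_zeroPadding_le (hM : ∀ k, 0 ≤ M k ∧ M k ≤ N) (hmono : Monotone M) {F : ℕ}
    (C : Caches N K F) (d : Fin K → Fin N) :
    (zeroPadding N K F C d).load
      ≤ loadLimit N M + Fintype.card (UserSets K) * deviation M C := by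
  rw [load_zeroPadding_eq_sum_userSets]
  refine (Finset.sum_le_sum fun U _ => maxSize_div_le hM hmono C d U).trans_eq ?_
  simp [loadLimit, Finset.sum_add_distrib]

lemma loadLimit_sub_le_fresh {F : ℕ} (C : Caches N K F) (d : Fin K → Fin N) :
    loadLimit N M - Fintype.card (UserSets K) * deviation M C
      ≤ ((∑ k, (fresh C d k).card : ℕ) : ℝ) / F := by
  rw [sum_card_fresh, Nat.cast_sum, Finset.sum_div]
  refine Eq.trans_le ?_ (Finset.sum_le_sum fun U _ => signalLimit_sub_deviation_le (M := M) C d U)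
  simp [loadLimit, Finset.sum_sub_distrib]

lemma fresh_le_load_zeroPadding {F : ℕ} (C : Caches N K F) (d : Fin K → Fin N) :
    ((∑ k, (fresh C d k).card : ℕ) : ℝ) / F ≤ (zeroPadding N K F C d).load := by
  rw [sum_card_fresh, Nat.cast_sum, Finset.sum_div, load_zeroPadding_eq_sum_userSets]
  refine Finset.sum_le_sum fun U _ => ?_
  gcongr
  exact Finset.le_sup (f := fun k => (segment C (d k) (U.1.erase k)).card) (U.1.min'_mem U.2)

lemma tendsto_expectedLoad_zeroPadding (hM : ∀ k, 0 ≤ M k ∧ M k ≤ N) (hmono : Monotone M)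
    (d : Fin K → Fin N) :
    Tendsto ((zeroPadding N K).expectedLoad M d) atTop (𝓝 (loadLimit N M)) := by
  have hdev := (tendsto_expect_deviation hM).const_mul (Fintype.card (UserSets K) : ℝ)
  rw [mul_zero] at hdev
  have hlow := hdev.const_sub (loadLimit N M)
  have hup := hdev.const_add (loadLimit N M)
  rw [sub_zero] at hlow
  rw [add_zero] at hup
  refine tendsto_of_tendsto_of_tendsto_of_le_of_le hlow hup (fun F => ?_) fun F => ?_
  · have h := Finset.expect_le_expect (s := placements N K M F) fun C _ =>
      (loadLimit_sub_le_fresh (M := M) C d).trans (fresh_le_load_zeroPadding C d)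
    simpa only [DeliveryScheme.expectedLoad, Finset.expect_sub_distrib, ← Finset.mul_expect,
      Finset.expect_const (placements_nonempty hM F)] using h
  · have h := Finset.expect_le_expect (s := placements N K M F) fun C _ =>
      load_zeroPadding_le hM hmono C d
    simpa only [DeliveryScheme.expectedLoad, Finset.expect_add_distrib, ← Finset.mul_expect,
      Finset.expect_const (placements_nonempty hM F)] using h

/-- The indicator of the event is bounded, for each placement, by a multiple of the deviation plus
twice the total error. Too short a signal makes the error term at least `1`; otherwise the load is
at least the fresh fraction, and a gap above `ε` forces a large deviation. -/
lemma tendsto_placementProb_load_lt (hM : ∀ k, 0 ≤ M k ∧ M k ≤ N) (hmono : Monotone M)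
    {d : Fin K → Fin N} (hd : d.Injective) {S : DeliveryScheme N K} (hS : S.ReliableUnder M d)
    {ε : ℝ} (hε : 0 < ε) :
    Tendsto (fun F : ℕ => placementProb N K M F fun C =>
      (S F C d).load + ε < (zeroPadding N K F C d).load) atTop (𝓝 0) := by
  classical
  have hbound := ((tendsto_expect_deviation hM).const_mul
    (2 * Fintype.card (UserSets K) / ε : ℝ)).add
    ((tendsto_finsetSum Finset.univ fun k _ => hS k).const_mul 2)
  simp only [Finset.sum_const_zero, mul_zero, add_zero] at hbound
  refine squeeze_zero (fun F => Finset.expect_nonneg fun C _ => ?_) (fun F => ?_) hbound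
  · split_ifs <;> norm_num
  simp only [placementProb, DeliveryScheme.errorProb]
  rw [← Finset.expect_sum_comm, Finset.mul_expect, Finset.mul_expect, ← Finset.expect_add_distrib]
  refine Finset.expect_le_expect fun C _ => ?_
  have hdev : 0 ≤ 2 * Fintype.card (UserSets K) / ε * deviation M C :=
    mul_nonneg (by positivity) (deviation_nonneg C)
  have herr : 0 ≤ ∑ k, 𝔼 W : Files N F,
      if (S F C d).decoded W k = W (d k) then (0 : ℝ) else 1 :=
    Finset.sum_nonneg fun k _ => Finset.expect_nonneg fun W _ => by split_ifs <;> norm_num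
  split_ifs with hE
  · rcases lt_or_ge (S F C d).len (∑ k, (fresh C d k).card) with hlt | hge
    · linarith [half_le_sum_error hd (S F C d) hlt]
    · have h1 : ((∑ k, (fresh C d k).card : ℕ) : ℝ) / F ≤ (S F C d).load := by
        rw [DeliveryCode.load]
        gcongr
      have h2 := load_zeroPadding_le hM hmono C d
      have h3 := loadLimit_sub_le_fresh (M := M) C d
      -- The factor `2` appears because the zero-padding load and the fresh fraction may each be off
      -- from `loadLimit` by the number of user sets times the deviation.
      have : 1 ≤ 2 * Fintype.card (UserSets K) / ε * deviation M C := by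
        rw [div_mul_eq_mul_div, le_div_iff₀ hε]
        linarith
      linarith
  · linarith

lemma loadLimit_le_loadUnder (hM : ∀ k, 0 ≤ M k ∧ M k ≤ N) (hmono : Monotone M)
    {d : Fin K → Fin N} (hd : d.Injective) {S : DeliveryScheme N K} (hS : S.ReliableUnder M d) :
    (loadLimit N M : EReal) ≤ S.loadUnder M d := by
  classical
  refine EReal.ge_of_forall_gt_iff_ge.1 fun z hz => ?_
  -- The gap `ε = loadLimit N M - z` makes the lower bound below converge to `z`.
  have hε : 0 < loadLimit N M - z := sub_pos.2 (EReal.coe_lt_coe_iff.1 hz)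
  have hlim := (((tendsto_expectedLoad_zeroPadding hM hmono d).sub_const (loadLimit N M - z)).sub
    ((tendsto_placementProb_load_lt hM hmono hd hS hε).const_mul (loadLimit N M))).sub
    ((tendsto_expect_deviation hM).const_mul (Fintype.card (UserSets K) : ℝ))
  simp only [mul_zero, sub_zero, sub_sub_cancel] at hlim
  rw [← (continuous_coe_real_ereal.continuousAt.tendsto.comp hlim).limsup_eq]
  refine limsup_le_limsup (Eventually.of_forall fun F => ?_)
  rw [Function.comp_apply, EReal.coe_le_coe_iff]
  -- On the bad event the subtracted terms make the left side negative, so `0 ≤ load` suffices and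
  -- no upper bound on the load of `S` is needed.
  have hle : ∀ C ∈ placements N K M F, (zeroPadding N K F C d).load - (loadLimit N M - z)
      - loadLimit N M * (if (S F C d).load + (loadLimit N M - z) < (zeroPadding N K F C d).load
        then 1 else 0) - Fintype.card (UserSets K) * deviation M C ≤ (S F C d).load := by
    intro C _
    have hdev : 0 ≤ Fintype.card (UserSets K) * deviation M C :=
      mul_nonneg (by positivity) (deviation_nonneg C)
    have hload : 0 ≤ (S F C d).load := by unfold DeliveryCode.load; positivity
    split_ifs with hE
    · linarith [load_zeroPadding_le hM hmono C d]
    · linarith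
  have h := Finset.expect_le_expect hle
  simp only [Finset.expect_sub_distrib, ← Finset.mul_expect,
    Finset.expect_const (placements_nonempty hM F)] at h
  unfold DeliveryScheme.expectedLoad placementProb
  convert h

lemma reliable_zeroPadding (N K : ℕ) (M : Fin K → ℝ) : (zeroPadding N K).Reliable M := by
  intro d k
  refine tendsto_const_nhds.congr fun F => ?_
  simp [DeliveryScheme.errorProb, decoded_zeroPadding]

lemma worstLoad_zeroPadding_le (hM : ∀ k, 0 ≤ M k ∧ M k ≤ N) (hmono : Monotone M) :
    (zeroPadding N K).worstLoad M ≤ loadLimit N M :=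
  iSup_le fun d => ((continuous_coe_real_ereal.tendsto _).comp
    (tendsto_expectedLoad_zeroPadding hM hmono d)).limsup_eq.le

end Comparison

end CodedCaching

theorem theorem2 (N K : ℕ) (hKN : K ≤ N) (M : Fin K → ℝ) (hM : ∀ k, 0 ≤ M k ∧ M k ≤ N)
    (hmono : Monotone M) :
    -- zero-padding delivery never fails
    (∀ (F : ℕ) (C : CodedCaching.Caches N K F) (d : Fin K → Fin N) (W : CodedCaching.Files N F)
      (k : Fin K), (CodedCaching.zeroPadding N K F C d).decoded W k = W (d k)) ∧
    -- its worst-case load is the smallest one among all reliable delivery schemes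
    IsLeast {R : EReal | ∃ S : CodedCaching.DeliveryScheme N K, S.Reliable M ∧ S.worstLoad M = R}
      ((CodedCaching.zeroPadding N K).worstLoad M) ∧
    -- for distinct requests, no scheme beats it by any fixed amount on a non-negligible set of
    -- placements
    (∀ d : Fin K → Fin N, Function.Injective d →
      ∀ S : CodedCaching.DeliveryScheme N K, S.ReliableUnder M d → ∀ ε : ℝ, 0 < ε →
        Tendsto (fun F : ℕ => CodedCaching.placementProb N K M F fun C =>
          (S F C d).load + ε < (CodedCaching.zeroPadding N K F C d).load) atTop (𝓝 0)) := by
  refine ⟨fun F C d W k => CodedCaching.decoded_zeroPadding C d W k,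
    ⟨⟨_, CodedCaching.reliable_zeroPadding N K M, rfl⟩, ?_⟩,
    fun d hd S hS ε hε => CodedCaching.tendsto_placementProb_load_lt hM hmono hd hS hε⟩
  rintro _ ⟨S, hS, rfl⟩
  refine (CodedCaching.worstLoad_zeroPadding_le hM hmono).trans ?_
  -- Since `K ≤ N`, user `k` can request file `k`; these distinct requests already force the worst
  -- case.
  exact (CodedCaching.loadLimit_le_loadUnder hM hmono (Fin.castLE_injective hKN) (hS _)).trans
    (le_iSup (fun d => S.loadUnder M d) _)
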